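/- Let $(W,S)$ be a finite, irreducible Coxeter system, with set of reflections $T=\bigcup_{w\in W} wSw^{-1}$, rank $\mathrm{rank}(W)=|S|$, and longest element $w_0$ (the unique element of maximal length with respect to $S$). For $w\in W$ let $\ell_T(w)$ be the smallest $k$ such that $w$ is a product of $k$ elements of $T$; write $v\le_T w$ if $\ell_T(v)+\ell_T(v^{-1}w)=\ell_T(w)$, and $[1,w]_T=\{v\in W : 1\le_T v\le_T w\}$. Let $P(w)$ denote the parabolic closure of $w$, i.e. the smallest subgroup of the form $x\langle I\rangle x^{-1}$ with $I\subseteq S$ and $x\in W$ that contains $w$. Let $u\in W$ satisfy $u^2=1$ and $u\neq 1$. The following are equivalent: 1. $P(u)=W$; 2. $t\le_T u$ for all $t\in T$; 3. $u\in Z(W)$, the center of $W$; 4. $\ell_T(u)=\mathrm{rank}(W)$. If these conditions hold, then $u=w_0$ and $[1,u]_T=\{v\in W : v^2=1\}$. -/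

import Mathlib

namespace CoxeterMatrix

/-- The Coxeter graph: two distinct vertices are joined iff `m(i, j) ≠ 2`, that is, iff
`m(i, j) ≥ 3` or `m(i, j) = ∞` (Mathlib encodes `∞` as `0`). -/
def coxeterGraph {B : Type*} (M : CoxeterMatrix B) : SimpleGraph B where
  Adj i j := i ≠ j ∧ M i j ≠ 2
  symm := ⟨fun i j h => ⟨h.1.symm, by rw [M.symmetric]; exact h.2⟩⟩
  loopless := ⟨fun _ h => h.1 rfl⟩

end CoxeterMatrix

namespace CoxeterSystem

variable {B W : Type*} [Group W] {M : CoxeterMatrix B} (cs : CoxeterSystem M W)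

/-- The Coxeter system is irreducible: its Coxeter graph is connected (and nonempty). -/
def IsIrreducible (_cs : CoxeterSystem M W) : Prop := M.coxeterGraph.Connected

/-- The rank of a Coxeter system: the number of its simple reflections. -/
noncomputable def rank (_cs : CoxeterSystem M W) : ℕ := Nat.card B

/-- The reflection length `ℓ_T(w)`: the smallest number of reflections with product `w`. -/
noncomputable def reflectionLength (w : W) : ℕ :=
  sInf {k | ∃ l : List W, (∀ t ∈ l, cs.IsReflection t) ∧ l.prod = w ∧ l.length = k}

/-- The infimum defining the reflection length is attained. -/
theorem exists_reflectionLength (w : W) :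
    ∃ l : List W, (∀ t ∈ l, cs.IsReflection t) ∧ l.prod = w ∧
      l.length = cs.reflectionLength w := by
  refine Nat.sInf_mem
    (s := {k | ∃ l : List W, (∀ t ∈ l, cs.IsReflection t) ∧ l.prod = w ∧ l.length = k}) ?_
  obtain ⟨ω, rfl⟩ := cs.wordProd_surjective w
  refine ⟨_, ω.map cs.simple, ?_, rfl, rfl⟩
  intro t ht
  obtain ⟨i, -, rfl⟩ := List.mem_map.1 ht
  exact cs.isReflection_simple i

/-- The absolute order: `u ≤_T v` iff `ℓ_T(u) + ℓ_T(u⁻¹ v) = ℓ_T(v)`. -/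
def AbsLE (u v : W) : Prop :=
  cs.reflectionLength u + cs.reflectionLength (u⁻¹ * v) = cs.reflectionLength v

/-- The interval `[u, v]_T` of the absolute order. -/
def absInterval (u v : W) : Set W := {w | cs.AbsLE u w ∧ cs.AbsLE w v}

/-- The standard parabolic subgroup `W_I` generated by the simple reflections in `I`. -/
def standardParabolic (I : Set B) : Subgroup W := Subgroup.closure (cs.simple '' I)

/-- A parabolic subgroup is a conjugate `w W_I w⁻¹` of a standard parabolic subgroup. -/
def IsParabolic (P : Subgroup W) : Prop :=
  ∃ (I : Set B) (w : W), P = (cs.standardParabolic I).map (MulAut.conj w).toMonoidHom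

/-- The parabolic closure `P(w)`: the intersection of all parabolic subgroups containing `w`.
Intersections of parabolic subgroups being parabolic, it is the smallest one containing `w`. -/
def parabolicClosure (w : W) : Subgroup W := sInf {P | cs.IsParabolic P ∧ w ∈ P}

/-- `P(w) = W` holds iff `W` itself is the smallest parabolic subgroup containing `w`. -/
theorem parabolicClosure_eq_top_iff (w : W) :
    cs.parabolicClosure w = ⊤ ↔ IsLeast {P | cs.IsParabolic P ∧ w ∈ P} ⊤ := by
  constructor
  · intro h
    refine ⟨⟨⟨Set.univ, 1, ?_⟩, Subgroup.mem_top w⟩, fun P hP => h ▸ sInf_le hP⟩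
    rw [standardParabolic, Set.image_univ, cs.subgroup_closure_range_simple]
    exact (Subgroup.map_top_of_surjective _ (MulAut.conj (1 : W)).surjective).symm
  · intro h
    exact top_le_iff.1 (le_sInf h.2)

/-- `w` is the longest element: every other element has strictly smaller length `ℓ_S`. -/
def IsLongestElement (w : W) : Prop := ∀ v : W, v ≠ w → cs.length v < cs.length w

end CoxeterSystem

/-! All four conditions say that `u` acts as `-1` in the geometric representation, whose basis is
the set of simple roots. This representation is faithful, because `w` makes the `i`-th simple root
negative as soon as `i` is a right descent of `w`. Since `W` is finite, it carries an invariant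
inner product.

Parabolic closure: an involution is conjugate into some `W_I` where it is `-1` on the roots of `I`
(Richardson), and `P(u) = W` forces `I` to be everything. Conversely `W_I` leaves the coordinates
outside `I` unchanged, so `-1` lies in no proper parabolic subgroup. Center: a central involution
scales each simple root by a sign, which is constant along the connected Coxeter graph; the sign
`+1` would give `u = 1`. Reflection length: the rank of `w - 1` is at most `ℓ_T(w)`, with equality
for involutions (Carter), so `ℓ_T(u) = rank` means that the `-1`-eigenspace is everything. Absolute
order: if `u = -1`, the moved spaces of `v` and `v⁻¹u` span the whole space, and `v ≤_T u` makes
their sum direct. As `vx - v⁻¹x` lies in both, `v² = 1`; the converse follows from Carter's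
equality. -/

/-! ### Root coefficients of dihedral groups -/

/-- The coefficients `sin ((k + 1) θ) / sin θ` of the roots of a dihedral group, where
`c = 2 cos θ`. -/
def dihedralCoeff (c : ℝ) : ℕ → ℝ
  | 0 => 1
  | 1 => c
  | k + 2 => c * dihedralCoeff c (k + 1) - dihedralCoeff c k

theorem dihedralCoeff_two (k : ℕ) : dihedralCoeff 2 k = k + 1 := by
  induction k using Nat.strong_induction_on with
  | _ k ih =>
    match k with
    | 0 => simp [dihedralCoeff]
    | 1 => simp [dihedralCoeff]; norm_num
    | k + 2 =>
      rw [dihedralCoeff, ih (k + 1) (by omega), ih k (by omega)]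
      push_cast; ring

theorem dihedralCoeff_mul_sin (θ : ℝ) (k : ℕ) :
    dihedralCoeff (2 * Real.cos θ) k * Real.sin θ = Real.sin ((k + 1) * θ) := by
  induction k using Nat.strong_induction_on with
  | _ k ih =>
    match k with
    | 0 => simp [dihedralCoeff]
    | 1 =>
      have : ((1 : ℕ) + 1 : ℝ) * θ = 2 * θ := by push_cast; ring
      rw [this, Real.sin_two_mul, dihedralCoeff]; ring
    | k + 2 =>
      have h1 := ih (k + 1) (by omega)
      have h2 := ih k (by omega)
      have e1 : (((k + 2 : ℕ) : ℝ) + 1) * θ = ((k + 1 : ℕ) + 1) * θ + θ := by push_cast; ring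
      have e2 : ((k : ℝ) + 1) * θ = ((k + 1 : ℕ) + 1) * θ - θ := by push_cast; ring
      rw [e2] at h2
      rw [Real.sin_sub] at h2
      rw [dihedralCoeff, e1, Real.sin_add]
      linear_combination 2 * Real.cos θ * h1 - h2

theorem dihedralCoeff_nonneg (m k : ℕ) (h1 : m ≠ 1) (hk : m ≠ 0 → k + 1 ≤ m) :
    0 ≤ dihedralCoeff (2 * Real.cos (Real.pi / m)) k := by
  rcases Nat.eq_zero_or_pos m with rfl | hm
  -- `m = 0` encodes `m = ∞`; division by zero gives the angle `0`, so `c = 2`, the correct value.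
  · simp only [Nat.cast_zero, div_zero, Real.cos_zero, mul_one, dihedralCoeff_two]; positivity
  · have hm2 : (2 : ℝ) ≤ m := by exact_mod_cast (by omega : 2 ≤ m)
    have hkm : ((k : ℝ) + 1) ≤ m := by exact_mod_cast hk hm.ne'
    have hs : 0 < Real.sin (Real.pi / m) := by
      apply Real.sin_pos_of_pos_of_lt_pi (by positivity)
      rw [div_lt_iff₀ (by linarith)]
      nlinarith [Real.pi_pos]
    have := dihedralCoeff_mul_sin (Real.pi / m) k
    have h2 : 0 ≤ Real.sin ((k + 1) * (Real.pi / m)) := by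
      apply Real.sin_nonneg_of_nonneg_of_le_pi (by positivity)
      rw [← mul_div_assoc, div_le_iff₀ (by linarith)]
      nlinarith [Real.pi_pos]
    rw [← this] at h2
    exact nonneg_of_mul_nonneg_left h2 hs

/-! ### The geometric representation -/

namespace CoxeterMatrix

variable {B : Type*} (M : CoxeterMatrix B)

/-- The simple coroots of the geometric representation. -/
noncomputable def coroot (i : B) : Module.Dual ℝ (B →₀ ℝ) :=
  Finsupp.linearCombination ℝ fun j => -2 * Real.cos (Real.pi / M i j)

theorem coroot_single (i j : B) (r : ℝ) :
    M.coroot i (Finsupp.single j r) = r * (-2 * Real.cos (Real.pi / M i j)) := by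
  simp [coroot]

theorem coroot_self (i : B) : M.coroot i (Finsupp.single i 1) = 2 := by
  simp [coroot_single]

theorem coroot_comm (i j : B) :
    M.coroot i (Finsupp.single j 1) = M.coroot j (Finsupp.single i 1) := by
  rw [coroot_single, coroot_single, M.symmetric]

theorem coroot_ne_zero {i j : B} (h : M i j ≠ 2) : M.coroot i (Finsupp.single j 1) ≠ 0 := by
  rw [coroot_single]
  rcases eq_or_ne (M i j) 0 with h0 | h0
  · simp [h0]
  rcases eq_or_ne (M i j) 1 with h1 | h1
  · simp [h1]
  have h3 : (3 : ℝ) ≤ M i j := by exact_mod_cast (by omega : 3 ≤ M i j)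
  have : 0 < Real.cos (Real.pi / M i j) := by
    apply Real.cos_pos_of_mem_Ioo
    have hpi := Real.pi_pos
    constructor
    · have : 0 < Real.pi / M i j := by positivity
      linarith
    · rw [div_lt_iff₀ (by linarith)]; nlinarith
  intro h; linarith

/-- The simple reflections of the geometric representation. -/
noncomputable def simpleReflection (i : B) : (B →₀ ℝ) ≃ₗ[ℝ] (B →₀ ℝ) :=
  Module.reflection (M.coroot_self i)

theorem simpleReflection_apply (i : B) (x : B →₀ ℝ) :
    M.simpleReflection i x = x - M.coroot i x • Finsupp.single i 1 :=
  Module.reflection_apply _ _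

/-- Two simple reflections multiply to a rotation by `φ = 2π/m`. The deviation of its `m`-th power
from the identity is given by Chebyshev polynomials at `2 cos φ`, and the relevant factors vanish.
The case `m = 2` is separate because there `sin φ = 0` cannot be divided out. -/
theorem isLiftable_simpleReflection : M.IsLiftable M.simpleReflection := by
  intro i j
  rcases eq_or_ne i j with rfl | hij
  · rw [M.diagonal, pow_one]
    ext1 x
    exact Module.involutive_reflection (M.coroot_self i) x
  have hm1 := M.off_diagonal i j hij
  change M i j ≠ 1 at hm1
  rcases eq_or_ne (M i j) 0 with h0 | h0
  · rw [h0, pow_zero]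
  have hc : M.coroot i (Finsupp.single j 1) = -2 * Real.cos (Real.pi / M i j) := by
    simp [coroot_single]
  have hc' := (M.coroot_comm i j).symm.trans hc
  rcases eq_or_ne (M i j) 2 with h2 | h2
  · rw [h2] at hc hc'
    rw [h2, pow_two]
    simp only [Nat.cast_ofNat, Real.cos_pi_div_two, mul_zero] at hc hc'
    refine LinearEquiv.ext fun x => ?_
    simp only [LinearEquiv.mul_apply, simpleReflection_apply, map_sub, map_smul, hc, hc',
      coroot_self, LinearEquiv.coe_one, id]
    module
  · refine LinearEquiv.ext fun z => ?_
    set m := M i j with hm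
    set φ : ℝ := 2 * (Real.pi / m) with hφ
    have hm3 : (3 : ℝ) ≤ m := by exact_mod_cast (by omega : 3 ≤ m)
    have hsin : Real.sin φ ≠ 0 := by
      apply ne_of_gt
      apply Real.sin_pos_of_pos_of_lt_pi (by positivity)
      rw [hφ, ← mul_div_assoc, div_lt_iff₀ (by linarith)]
      nlinarith [Real.pi_pos]
    have ht : 2 * Real.cos φ = M.coroot i (Finsupp.single j 1) *
        M.coroot j (Finsupp.single i 1) - 2 := by
      rw [hc, hc', hφ, Real.cos_two_mul]; ring
    have hS : ∀ k : ℤ, (Polynomial.Chebyshev.S ℝ k).eval (2 * Real.cos φ) * Real.sin φ =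
        Real.sin ((k + 1) * φ) := by
      intro k
      rw [← Polynomial.Chebyshev.U_real_cos]
      simp [Polynomial.Chebyshev.S_eq_U_comp_half_mul_X]
    have key := Module.reflection_mul_reflection_pow_apply (M.coroot_self i) (M.coroot_self j)
      m z _ ht
    rw [show ((M.simpleReflection i * M.simpleReflection j) ^ m) z = _ from key]
    rcases Nat.even_or_odd' m with ⟨k, hk | hk⟩
    · have hz : (Polynomial.Chebyshev.S ℝ (k - 1)).eval (2 * Real.cos φ) = 0 := by
        have := hS (k - 1)
        have e : (((k - 1 : ℤ) : ℝ) + 1) * φ = Real.pi := by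
          rw [hφ, hk]; push_cast
          have : (k : ℝ) ≠ 0 := by
            intro h; have : k = 0 := by exact_mod_cast h
            omega
          field_simp; ring
        rw [e, Real.sin_pi] at this
        exact (mul_eq_zero.1 this).resolve_right hsin
      have e1 : ((m : ℤ) - 2) / 2 = k - 1 := by omega
      have e2 : ((m : ℤ) - 1) / 2 = k - 1 := by omega
      rw [e1, e2, hz]; simp
    -- For `m = 2k + 1` the angles `(k + 1)φ` and `kφ` add up to `2π`, so their sines cancel.
    · have hz : (Polynomial.Chebyshev.S ℝ k).eval (2 * Real.cos φ) +
          (Polynomial.Chebyshev.S ℝ (k - 1)).eval (2 * Real.cos φ) = 0 := by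
        have h1 := hS (k - 1)
        have h2 := hS k
        have e : (((k : ℤ) : ℝ) + 1) * φ = 2 * Real.pi - (((k - 1 : ℤ) : ℝ) + 1) * φ := by
          rw [hφ, hk]; push_cast
          have : (2 * (k : ℝ) + 1) ≠ 0 := by positivity
          field_simp; ring
        rw [e, Real.sin_two_pi_sub] at h2
        refine (mul_eq_zero.1 (?_ : _ * Real.sin φ = 0)).resolve_right hsin
        rw [add_mul, h1, h2]; ring
      have e1 : ((m : ℤ) - 2) / 2 = k - 1 := by omega
      have e2 : ((m : ℤ) - 1) / 2 = k := by omega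
      have e3 : ((m : ℤ) - 3) / 2 = k - 1 := by omega
      have e4 : (m : ℤ) / 2 = k := by omega
      rw [e1, e2, e3, e4, hz]; simp

end CoxeterMatrix

namespace CoxeterSystem

variable {B W : Type*} [Group W] {M : CoxeterMatrix B} (cs : CoxeterSystem M W)

/-- The geometric representation of a Coxeter group. -/
noncomputable def geomRep : W →* Module.End ℝ (B →₀ ℝ) :=
  (LinearEquiv.automorphismGroup.toLinearMapMonoidHom (R := ℝ) (M := B →₀ ℝ)).comp
    (cs.lift ⟨M.simpleReflection, M.isLiftable_simpleReflection⟩)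

theorem geomRep_simple (i : B) (x : B →₀ ℝ) :
    cs.geomRep (cs.simple i) x = x - M.coroot i x • Finsupp.single i 1 := by
  rw [geomRep, MonoidHom.comp_apply, cs.lift_apply_simple, ← M.simpleReflection_apply]
  rfl

theorem geomRep_mul (v w : W) (x : B →₀ ℝ) :
    cs.geomRep (v * w) x = cs.geomRep v (cs.geomRep w x) := by
  rw [map_mul]; rfl

theorem geomRep_one (x : B →₀ ℝ) : cs.geomRep 1 x = x := by
  rw [map_one]; rfl

theorem geomRep_inv_apply (w : W) (x : B →₀ ℝ) : cs.geomRep w⁻¹ (cs.geomRep w x) = x := by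
  rw [← geomRep_mul, inv_mul_cancel, geomRep_one]

theorem geomRep_apply_inv (w : W) (x : B →₀ ℝ) : cs.geomRep w (cs.geomRep w⁻¹ x) = x := by
  rw [← geomRep_mul, mul_inv_cancel, geomRep_one]

theorem geomRep_simple_single (i : B) :
    cs.geomRep (cs.simple i) (Finsupp.single i 1) = -Finsupp.single i 1 := by
  rw [geomRep_simple, M.coroot_self]; module

/-- The word ends in `j`, so it starts by adding to the `i`-th root a multiple of the `j`-th. Each
further letter on the left changes only the coefficient of its own root, by one step of the
recurrence of `dihedralCoeff`. -/
theorem geomRep_alternatingWord (i j : B) (k : ℕ) :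
    cs.geomRep (cs.wordProd (alternatingWord i j (k + 1))) (Finsupp.single i 1) =
      if Even k then
        dihedralCoeff (2 * Real.cos (Real.pi / M i j)) k • Finsupp.single i 1 +
        dihedralCoeff (2 * Real.cos (Real.pi / M i j)) (k + 1) • Finsupp.single j 1
      else
        dihedralCoeff (2 * Real.cos (Real.pi / M i j)) k • Finsupp.single j 1 +
        dihedralCoeff (2 * Real.cos (Real.pi / M i j)) (k + 1) • Finsupp.single i 1 := by
  have h1 : M.coroot i (Finsupp.single j 1) = -2 * Real.cos (Real.pi / M i j) := by
    simp [M.coroot_single]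
  have h2 := (M.coroot_comm i j).symm.trans h1
  induction k with
  | zero =>
    simp only [alternatingWord, List.concat_eq_append, List.nil_append,
      wordProd_singleton, geomRep_simple, h2, dihedralCoeff, Even.zero, if_true]
    module
  | succ k ih =>
    rw [alternatingWord_succ', wordProd_cons, geomRep_mul, ih]
    rcases Nat.even_or_odd k with hk | hk
    · have hk' : ¬ Even (k + 1) := by simpa [Nat.even_add_one] using hk
      simp only [hk, hk', if_true, if_false, geomRep_simple, map_add, map_smul, h1, M.coroot_self,
        dihedralCoeff]
      module
    · have hk0 : ¬ Even k := by simpa using hk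
      have hk' : Even (k + 1) := by simpa [Nat.even_add_one] using hk
      simp only [hk0, hk', if_true, if_false, geomRep_simple, map_add, map_smul, h2, M.coroot_self,
        dihedralCoeff]
      module

/-! ### Positivity of roots and faithfulness -/

/-- The maximal dihedral right factor of an element of a Coxeter group. -/
theorem exists_eq_mul_alternatingWord (i j : B) (w : W) :
    ∃ (v : W) (k : ℕ) (a b : B), ((a = i ∧ b = j) ∨ (a = j ∧ b = i)) ∧
      w = v * cs.wordProd (alternatingWord a b k) ∧ cs.length w = cs.length v + k ∧
      ¬ cs.IsRightDescent v i ∧ ¬ cs.IsRightDescent v j := by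
  induction hn : cs.length w using Nat.strong_induction_on generalizing w with
  | _ n ih =>
    subst hn
    by_cases h : ¬ cs.IsRightDescent w i ∧ ¬ cs.IsRightDescent w j
    · exact ⟨w, 0, i, j, Or.inl ⟨rfl, rfl⟩, by simp [alternatingWord], rfl, h⟩
    obtain ⟨c, d, hcd, hc⟩ : ∃ c d, ((c = i ∧ d = j) ∨ (c = j ∧ d = i)) ∧
        cs.IsRightDescent w c := by
      by_cases hi : cs.IsRightDescent w i
      · exact ⟨i, j, Or.inl ⟨rfl, rfl⟩, hi⟩
      · exact ⟨j, i, Or.inr ⟨rfl, rfl⟩, by tauto⟩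
    obtain ⟨v, k, a, b, hab, he, hl, hv⟩ := ih _ hc (w * cs.simple c) rfl
    have hw : w = v * cs.wordProd (alternatingWord a b k) * cs.simple c := by
      rw [← he]; simp
    rw [cs.isRightDescent_iff] at hc
    by_cases hcb : a = c
    · subst hcb
      refine ⟨v, k + 1, b, a, by tauto, ?_, by omega, hv⟩
      rw [alternatingWord_succ, wordProd_concat, ← mul_assoc, hw]
    · rcases k with _ | k
      · refine ⟨v, 1, d, c, by tauto, ?_, by omega, hv⟩
        rw [hw]; simp [alternatingWord]
      -- The dihedral factor already ends in `c`, so multiplying by `c` cancels a letter and `w`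
      -- would be shorter than `w * cs.simple c`.
      · exfalso
        have hbc : b = c := by
          rcases hab with h | h <;> rcases hcd with h' | h' <;> grind
        subst hbc
        rw [alternatingWord_succ, wordProd_concat, ← mul_assoc,
          simple_mul_simple_cancel_right] at hw
        have h1 := cs.length_mul_le v (cs.wordProd (alternatingWord b a k))
        have h2 := cs.length_wordProd_le (alternatingWord b a k)
        rw [length_alternatingWord] at h2
        rw [← hw] at h1
        omega

/-- If `ℓ(w sᵢ) > ℓ(w)`, then `w` maps the `i`-th simple root to a positive root. -/
theorem geomRep_single_nonneg {w : W} {i : B} (h : ¬ cs.IsRightDescent w i) (b : B) :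
    0 ≤ cs.geomRep w (Finsupp.single i 1) b := by
  classical
  induction hn : cs.length w using Nat.strong_induction_on generalizing w i b with
  | _ n ih =>
    subst hn
    rcases eq_or_ne w 1 with rfl | hw
    · rw [geomRep_one, Finsupp.single_apply]; split_ifs <;> norm_num
    -- Splitting off a dihedral factor in `i` and a descent `j` leaves a strictly shorter `v`, to
    -- which induction applies at both `i` and `j`.
    obtain ⟨j, hj⟩ := cs.exists_rightDescent_of_ne_one hw
    obtain ⟨v, k, a, c, hac, he, hl, hvi, hvj⟩ := cs.exists_eq_mul_alternatingWord i j w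
    have hij : i ≠ j := by rintro rfl; exact h hj
    rw [cs.not_isRightDescent_iff] at h
    rcases k with _ | k
    · simp only [alternatingWord, wordProd_nil, mul_one] at he
      exact absurd hj (he ▸ hvj)
    have hc : a = i ∧ c = j := by
      rcases hac with h' | ⟨rfl, rfl⟩
      · exact h'
      exfalso
      rw [alternatingWord_succ, wordProd_concat, ← mul_assoc] at he
      have hw' : w * cs.simple c = v * cs.wordProd (alternatingWord c a k) := by
        rw [he]; simp
      have h1 := cs.length_mul_le v (cs.wordProd (alternatingWord c a k))
      have h2 := cs.length_wordProd_le (alternatingWord c a k)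
      rw [length_alternatingWord] at h2
      rw [hw'] at h
      omega
    obtain ⟨rfl, rfl⟩ := hc
    -- Appending `a` still increases the length of `w`, so the alternating word of length `k + 2` is
    -- reduced and cannot be longer than `M a c`.
    have hk : M a c ≠ 0 → k + 1 + 1 ≤ M a c := by
      intro h0
      by_contra hlt
      have hnr := cs.not_isReduced_alternatingWord c a (m := k + 1 + 1) (by rwa [M.symmetric])
        (by rw [M.symmetric]; omega)
      apply hnr
      unfold IsReduced
      have h2 := cs.length_wordProd_le (alternatingWord c a (k + 1 + 1))
      have h1 := cs.length_mul_le v (cs.wordProd (alternatingWord c a (k + 1 + 1)))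
      rw [show v * cs.wordProd (alternatingWord c a (k + 1 + 1)) = w * cs.simple a by
        rw [alternatingWord_succ, wordProd_concat, ← mul_assoc, he]] at h1
      rw [length_alternatingWord] at h2 ⊢
      omega
    have hM1 : M a c ≠ 1 := M.off_diagonal a c hij
    have hp := dihedralCoeff_nonneg (M a c) k hM1 (fun h => by have := hk h; omega)
    have hq := dihedralCoeff_nonneg (M a c) (k + 1) hM1 hk
    have ha := ih (cs.length v) (by omega) hvi b rfl
    have hb := ih (cs.length v) (by omega) hvj b rfl
    rw [he, geomRep_mul, geomRep_alternatingWord]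
    split_ifs
    · simp only [map_add, map_smul, Finsupp.add_apply, Finsupp.smul_apply, smul_eq_mul]; positivity
    · simp only [map_add, map_smul, Finsupp.add_apply, Finsupp.smul_apply, smul_eq_mul]; positivity

theorem geomRep_single_nonpos {w : W} {i : B} (h : cs.IsRightDescent w i) (b : B) :
    cs.geomRep w (Finsupp.single i 1) b ≤ 0 := by
  have := cs.geomRep_single_nonneg (cs.isRightDescent_iff_not_isRightDescent_mul.1 h) b
  rw [geomRep_mul, geomRep_simple_single, map_neg, Finsupp.neg_apply] at this
  linarith

theorem geomRep_injective : Function.Injective cs.geomRep := by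
  rw [injective_iff_map_eq_one]
  intro w hw
  by_contra h
  obtain ⟨i, hi⟩ := cs.exists_rightDescent_of_ne_one h
  have := cs.geomRep_single_nonpos hi i
  rw [hw, Module.End.one_apply, Finsupp.single_eq_same] at this
  linarith

/-- The reflection at `j` changes only the `j`-th coordinate, so it cannot negate another simple
root. This makes `B` finite when `W` is. -/
theorem simple_injective : Function.Injective cs.simple := by
  intro i j h
  by_contra hij
  have h1 := cs.geomRep_simple_single i
  rw [h, geomRep_simple] at h1
  have := DFunLike.congr_fun h1 i
  simp [Ne.symm hij] at this
  linarith

/-! ### The invariant inner product -/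

/-- A bilinear form is an invariant inner product for the geometric representation. -/
structure IsInvariantInner (q : LinearMap.BilinForm ℝ (B →₀ ℝ)) : Prop where
  comm : ∀ x y, q x y = q y x
  pos : ∀ x, x ≠ 0 → 0 < q x x
  inv : ∀ w x y, q (cs.geomRep w x) (cs.geomRep w y) = q x y

theorem finite_index (cs : CoxeterSystem M W) [Finite W] : Finite B := Finite.of_injective _ cs.simple_injective

theorem exists_isInvariantInner [Finite W] : ∃ q, cs.IsInvariantInner q := by
  have := cs.finite_index
  cases nonempty_fintype B
  cases nonempty_fintype W
  -- The coordinate inner product, summed over the group.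
  refine ⟨LinearMap.mk₂ ℝ (fun x y => ∑ w : W, ∑ b : B, cs.geomRep w x b * cs.geomRep w y b)
    ?_ ?_ ?_ ?_, ?_, ?_, ?_⟩
  · intro x y z
    simp [add_mul, Finset.sum_add_distrib]
  · intro c x y
    simp [Finset.mul_sum, mul_assoc]
  · intro x y z
    simp [mul_add, Finset.sum_add_distrib]
  · intro c x y
    simp [Finset.mul_sum, mul_left_comm]
  · intro x y
    simp [mul_comm]
  · intro x hx
    obtain ⟨b, hb⟩ := Finsupp.ne_iff.1 hx
    rw [LinearMap.mk₂_apply]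
    refine Finset.sum_pos' (fun w _ => Finset.sum_nonneg fun b _ => mul_self_nonneg _)
      ⟨1, Finset.mem_univ _, ?_⟩
    refine Finset.sum_pos' (fun b _ => mul_self_nonneg _) ⟨b, Finset.mem_univ _, ?_⟩
    rw [geomRep_one]
    exact mul_self_pos.2 hb
  · intro v x y
    simp only [LinearMap.mk₂_apply, ← geomRep_mul]
    exact Fintype.sum_equiv (Equiv.mulRight v) _ _ fun w => rfl

theorem IsInvariantInner.single_pos {cs : CoxeterSystem M W} {q : LinearMap.BilinForm ℝ (B →₀ ℝ)}
    (hq : cs.IsInvariantInner q) (i : B) : 0 < q (Finsupp.single i 1) (Finsupp.single i 1) :=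
  hq.pos _ (by simp)

/-- Invariance under the `i`-th reflection identifies the coroot with the inner product with the
root, up to a positive factor. Signs and zeros of coroots thus become signs of inner products and
orthogonality. -/
theorem IsInvariantInner.two_mul_apply_single {cs : CoxeterSystem M W}
    {q : LinearMap.BilinForm ℝ (B →₀ ℝ)} (hq : cs.IsInvariantInner q) (x : B →₀ ℝ) (i : B) :
    2 * q x (Finsupp.single i 1) =
      M.coroot i x * q (Finsupp.single i 1) (Finsupp.single i 1) := by
  have := hq.inv (cs.simple i) x (Finsupp.single i 1)
  rw [geomRep_simple_single, geomRep_simple] at this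
  simp only [map_sub, map_neg, map_smul, LinearMap.sub_apply, LinearMap.smul_apply,
    smul_eq_mul] at this
  linarith

/-- `v` is orthogonal and preserves the line of the root, hence commutes with the reflection in it.
-/
theorem simple_commute [Finite W] {v : W} {i : B}
    (h : cs.geomRep v (Finsupp.single i 1) = -Finsupp.single i 1) :
    v * cs.simple i = cs.simple i * v := by
  obtain ⟨q, hq⟩ := cs.exists_isInvariantInner
  apply cs.geomRep_injective
  refine LinearMap.ext fun x => ?_
  have h1 := hq.two_mul_apply_single x i
  have h2 := hq.two_mul_apply_single (cs.geomRep v x) i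
  have h3 := hq.inv v x (Finsupp.single i 1)
  rw [h, map_neg] at h3
  have h4 : M.coroot i (cs.geomRep v x) = -M.coroot i x := by
    apply mul_right_cancel₀ (hq.single_pos i).ne'
    linarith
  rw [geomRep_mul, geomRep_mul, geomRep_simple, geomRep_simple, map_sub, map_smul, h, h4]
  module

/-! ### Standard parabolic subgroups, stabilizers and involutions -/

theorem simple_mem_standardParabolic {I : Set B} {i : B} (h : i ∈ I) :
    cs.simple i ∈ cs.standardParabolic I :=
  Subgroup.subset_closure ⟨i, h, rfl⟩

/-- Each generator subtracts a multiple of a root in `I`. The untouched coordinates serve to detect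
elements outside `W_I`. -/
theorem geomRep_apply_of_mem_standardParabolic {I : Set B} {w : W}
    (hw : w ∈ cs.standardParabolic I) (x : B →₀ ℝ) {b : B} (hb : b ∉ I) :
    cs.geomRep w x b = x b := by
  induction hw using Subgroup.closure_induction generalizing x with
  | mem w hw =>
    obtain ⟨i, hi, rfl⟩ := hw
    have : i ≠ b := by rintro rfl; exact hb hi
    simp [geomRep_simple, this]
  | one => rw [geomRep_one]
  | mul v w _ _ hv hw => rw [geomRep_mul, hv, hw]
  | inv w _ hw => rw [← hw (cs.geomRep w⁻¹ x), geomRep_apply_inv]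

theorem standardParabolic_univ : cs.standardParabolic Set.univ = ⊤ := by
  rw [standardParabolic, Set.image_univ, cs.subgroup_closure_range_simple]

theorem standardParabolic_eq_top_iff {I : Set B} :
    cs.standardParabolic I = ⊤ ↔ I = Set.univ := by
  refine ⟨fun h => ?_, fun h => h ▸ cs.standardParabolic_univ⟩
  rw [Set.eq_univ_iff_forall]
  intro i
  by_contra hi
  have := cs.geomRep_apply_of_mem_standardParabolic (h ▸ Subgroup.mem_top (cs.simple i))
    (Finsupp.single i 1) hi
  rw [geomRep_simple_single] at this
  simp at this
  linarith

/-- Every vector can be moved by a standard parabolic subgroup into its closed chamber. -/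
theorem exists_dominant [Finite W] (I : Set B) (x : B →₀ ℝ) :
    ∃ w ∈ cs.standardParabolic I, ∀ i ∈ I, 0 ≤ M.coroot i (cs.geomRep w x) := by
  have hB := cs.finite_index
  cases nonempty_fintype B
  -- A `w` maximizing the coordinate sum of `w x`: the `i`-th reflection changes this sum by minus
  -- the `i`-th coroot, which is therefore nonnegative.
  obtain ⟨⟨w, hw⟩, hmax⟩ := Finite.exists_max
    fun w : cs.standardParabolic I => ∑ b, cs.geomRep (w : W) x b
  refine ⟨w, hw, fun i hi => ?_⟩
  have := hmax ⟨cs.simple i * w, mul_mem (cs.simple_mem_standardParabolic hi) hw⟩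
  simp only [geomRep_mul, geomRep_simple, Finsupp.sub_apply, Finset.sum_sub_distrib,
    Finsupp.smul_apply, smul_eq_mul, ← Finset.mul_sum] at this
  classical
  simp only [Finsupp.single_apply, Finset.sum_ite_eq, Finset.mem_univ, if_true] at this
  linarith

/-- The stabilizer of a point of the closed chamber is a standard parabolic subgroup. -/
theorem mem_standardParabolic_of_fixed [Finite W] {I : Set B} {y : B →₀ ℝ}
    (hy : ∀ i ∈ I, 0 ≤ M.coroot i y) {w : W} (hw : w ∈ cs.standardParabolic I)
    (hfix : cs.geomRep w y = y) :
    w ∈ cs.standardParabolic {i ∈ I | M.coroot i y = 0} := by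
  classical
  have hB := cs.finite_index
  cases nonempty_fintype B
  obtain ⟨q, hq⟩ := cs.exists_isInvariantInner
  induction hn : cs.length w using Nat.strong_induction_on generalizing w with
  | _ n ih =>
    subst hn
    rcases eq_or_ne w 1 with rfl | h1
    · exact one_mem _
    obtain ⟨i, hi⟩ := cs.exists_rightDescent_of_ne_one h1
    have hneg := cs.geomRep_single_nonpos hi
    have hiI : i ∈ I := by
      by_contra hiI
      have := hneg i
      rw [cs.geomRep_apply_of_mem_standardParabolic hw _ hiI, Finsupp.single_eq_same] at this
      linarith
    -- As `w` fixes `y`, the product of `y` with the `i`-th root equals that with its image under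
    -- `w`. This image is a nonpositive combination of roots in `I`, on which `y` is nonnegative.
    have hle : q y (Finsupp.single i 1) ≤ 0 := by
      rw [← hq.inv w, hfix]
      nth_rw 1 [← Finsupp.univ_sum_single (cs.geomRep w (Finsupp.single i 1))]
      rw [map_sum]
      refine Finset.sum_nonpos fun b _ => ?_
      rw [← mul_one (cs.geomRep w (Finsupp.single i 1) b), ← smul_eq_mul, ← Finsupp.smul_single,
        map_smul, smul_eq_mul]
      by_cases hb : b ∈ I
      · refine mul_nonpos_of_nonpos_of_nonneg (hneg b) ?_
        have := hq.two_mul_apply_single y b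
        have := mul_nonneg (hy b hb) (hq.single_pos b).le
        linarith
      · have hbi : i ≠ b := by rintro rfl; exact hb hiI
        rw [cs.geomRep_apply_of_mem_standardParabolic hw _ hb]
        simp [hbi]
    have h0 : M.coroot i y = 0 := by
      refine le_antisymm ?_ (hy i hiI)
      have := hq.two_mul_apply_single y i
      exact nonpos_of_mul_nonpos_left (this ▸ by linarith) (hq.single_pos i)
    have hs := ih _ hi (mul_mem hw (cs.simple_mem_standardParabolic hiI))
      (by rw [geomRep_mul, geomRep_simple, h0, zero_smul, sub_zero, hfix]) rfl
    have := mul_mem hs (cs.simple_mem_standardParabolic (I := {i ∈ I | M.coroot i y = 0}) ⟨hiI, h0⟩)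
    rwa [simple_mul_simple_cancel_right] at this

/-- Richardson: an involution is conjugate to an element of a standard parabolic subgroup acting
as `-1` on the span of the corresponding simple roots. -/
theorem exists_conj_mem_standardParabolic [Finite W] {v : W} (hv : v ^ 2 = 1) :
    ∃ (w : W) (I : Set B), w * v * w⁻¹ ∈ cs.standardParabolic I ∧
      ∀ i ∈ I, cs.geomRep (w * v * w⁻¹) (Finsupp.single i 1) = -Finsupp.single i 1 := by
  have hB := cs.finite_index
  cases nonempty_fintype B
  -- `I` is minimal such that `W_I` contains a conjugate of `v`.
  obtain ⟨I, ⟨w, hw⟩, hmin⟩ := (wellFounded_lt : WellFounded (α := Set B) (· < ·)).has_min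
    {I | ∃ w, w * v * w⁻¹ ∈ cs.standardParabolic I}
    ⟨Set.univ, 1, by rw [standardParabolic_univ]; exact Subgroup.mem_top _⟩
  refine ⟨w, I, hw, fun i hi => ?_⟩
  by_contra hne
  set z := w * v * w⁻¹ with hz
  have hzz : z * z = 1 := by
    rw [hz]
    rw [pow_two] at hv
    simp only [mul_assoc, inv_mul_cancel_left]
    rw [← mul_assoc v v, hv, one_mul, mul_inv_cancel]
  -- If `z` does not negate the root, `x` is a nonzero vector fixed by `z` in the span of the roots
  -- of `I`. Moving it into the closed chamber places a conjugate of `z` in the stabilizer, a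
  -- smaller standard parabolic subgroup.
  set x := Finsupp.single i 1 + cs.geomRep z (Finsupp.single i 1) with hx
  have hx0 : x ≠ 0 := fun h => hne (eq_neg_of_add_eq_zero_right h)
  have hxz : cs.geomRep z x = x := by
    rw [hx, map_add, ← geomRep_mul, hzz, geomRep_one, add_comm]
  have hxI : ∀ b ∉ I, x b = 0 := by
    intro b hb
    have hbi : i ≠ b := by rintro rfl; exact hb hi
    rw [hx, Finsupp.add_apply, cs.geomRep_apply_of_mem_standardParabolic hw _ hb]
    simp [hbi]
  obtain ⟨a, ha, hdom⟩ := cs.exists_dominant I x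
  have hfix : cs.geomRep (a * z * a⁻¹) (cs.geomRep a x) = cs.geomRep a x := by
    rw [← geomRep_mul, inv_mul_cancel_right, geomRep_mul, hxz]
  have hmem := cs.mem_standardParabolic_of_fixed hdom
    (mul_mem (mul_mem ha hw) (inv_mem ha)) hfix
  refine hmin _ ⟨a * w, ?_⟩ (lt_of_le_of_ne (Set.sep_subset I
    fun i => M.coroot i (cs.geomRep a x) = 0) fun hEq => ?_)
  · rw [hz] at hmem
    simpa only [mul_assoc, mul_inv_rev] using hmem
  -- If the stabilizer were all of `W_I`, the moved vector would be orthogonal to all roots of `I`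
  -- while lying in their span, hence zero.
  · obtain ⟨q, hq⟩ := cs.exists_isInvariantInner
    have hy0 : cs.geomRep a x ≠ 0 := fun h => hx0 (by
      rw [← cs.geomRep_inv_apply a x, h, map_zero])
    refine (hq.pos _ hy0).ne' ?_
    nth_rw 2 [← Finsupp.univ_sum_single (cs.geomRep a x)]
    rw [map_sum]
    refine Finset.sum_eq_zero fun b _ => ?_
    rw [← mul_one (cs.geomRep a x b), ← smul_eq_mul, ← Finsupp.smul_single,
      map_smul, smul_eq_mul]
    by_cases hb : b ∈ I
    · have h0 : M.coroot b (cs.geomRep a x) = 0 := (hEq.ge hb).2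
      have := hq.two_mul_apply_single (cs.geomRep a x) b
      rw [h0, zero_mul] at this
      rw [(by linarith : q (cs.geomRep a x) (Finsupp.single b 1) = 0), mul_zero]
    · rw [cs.geomRep_apply_of_mem_standardParabolic ha _ hb, hxI b hb, zero_mul]

/-! ### Reflection length and moved spaces -/

theorem reflectionLength_le (l : List W) (hl : ∀ t ∈ l, cs.IsReflection t) :
    cs.reflectionLength l.prod ≤ l.length :=
  Nat.sInf_le ⟨l, hl, rfl, rfl⟩

theorem reflectionLength_one : cs.reflectionLength 1 = 0 :=
  Nat.le_zero.1 (cs.reflectionLength_le [] (by simp))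

theorem reflectionLength_mul_le {t : W} (ht : cs.IsReflection t) (w : W) :
    cs.reflectionLength (t * w) ≤ cs.reflectionLength w + 1 := by
  obtain ⟨l, hl, rfl, hlen⟩ := cs.exists_reflectionLength w
  have := cs.reflectionLength_le (t :: l) (List.forall_mem_cons.2 ⟨ht, hl⟩)
  rwa [List.prod_cons, List.length_cons, hlen] at this

/-- The moved space of `w`, that is, the range of `w - 1` in the geometric representation. -/
noncomputable def movedSpace (w : W) : Submodule ℝ (B →₀ ℝ) :=
  LinearMap.range (cs.geomRep w - 1)

theorem mem_movedSpace {w : W} {y : B →₀ ℝ} :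
    y ∈ cs.movedSpace w ↔ ∃ x, cs.geomRep w x - x = y := Iff.rfl

/-- The moved space of a product with a reflection is contained in the span of the root and the
moved space of the other factor. -/
theorem movedSpace_reflection_mul_le (g : W) (i : B) (w : W) :
    cs.movedSpace (g * cs.simple i * g⁻¹ * w) ≤
      Submodule.span ℝ {cs.geomRep g (Finsupp.single i 1)} ⊔ cs.movedSpace w := by
  rintro _ ⟨x, rfl⟩
  refine Submodule.mem_sup.2 ⟨-(M.coroot i (cs.geomRep g⁻¹ (cs.geomRep w x))) •
    cs.geomRep g (Finsupp.single i 1), Submodule.smul_mem _ _ (Submodule.mem_span_singleton_self _),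
    cs.geomRep w x - x, ⟨x, rfl⟩, ?_⟩
  rw [LinearMap.sub_apply, Module.End.one_apply, geomRep_mul, geomRep_mul, geomRep_mul,
    geomRep_simple, map_sub, map_smul, geomRep_apply_inv]
  module

theorem finrank_movedSpace_reflection_mul_le [Finite B] {t : W} (ht : cs.IsReflection t) (w : W) :
    Module.finrank ℝ (cs.movedSpace (t * w)) ≤ Module.finrank ℝ (cs.movedSpace w) + 1 := by
  obtain ⟨g, i, rfl⟩ := ht
  have h1 := Submodule.finrank_mono (cs.movedSpace_reflection_mul_le g i w)
  have h2 := Submodule.finrank_add_le_finrank_add_finrank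
    (Submodule.span ℝ {cs.geomRep g (Finsupp.single i 1)}) (cs.movedSpace w)
  have h3 := finrank_span_le_card (R := ℝ) ({cs.geomRep g (Finsupp.single i 1)} : Set (B →₀ ℝ))
  simp only [Set.toFinset_singleton, Finset.card_singleton] at h3
  omega

theorem movedSpace_one : cs.movedSpace 1 = ⊥ := by
  rw [Submodule.eq_bot_iff]
  rintro _ ⟨x, rfl⟩
  rw [LinearMap.sub_apply, Module.End.one_apply, geomRep_one, sub_self]

/-- Each reflection adds at most one dimension to the moved space. -/
theorem finrank_movedSpace_le [Finite B] (w : W) :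
    Module.finrank ℝ (cs.movedSpace w) ≤ cs.reflectionLength w := by
  obtain ⟨l, hl, rfl, hlen⟩ := cs.exists_reflectionLength w
  rw [← hlen]
  clear hlen
  induction l with
  | nil => rw [List.prod_nil, movedSpace_one, finrank_bot]; exact Nat.zero_le _
  | cons t l ih =>
    rw [List.forall_mem_cons] at hl
    rw [List.prod_cons, List.length_cons]
    exact (cs.finrank_movedSpace_reflection_mul_le hl.1 _).trans (Nat.succ_le_succ (ih hl.2))

theorem mem_movedSpace_iff_of_sq_eq_one {v : W} (hv : v ^ 2 = 1) {x : B →₀ ℝ} :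
    x ∈ cs.movedSpace v ↔ cs.geomRep v x = -x := by
  have hvv : ∀ y, cs.geomRep v (cs.geomRep v y) = y := fun y => by
    rw [← geomRep_mul, ← pow_two, hv, geomRep_one]
  rw [mem_movedSpace]
  constructor
  · rintro ⟨y, rfl⟩
    rw [map_sub, hvv]; abel
  · intro h
    refine ⟨(-1 / 2 : ℝ) • x, ?_⟩
    rw [map_smul, h]; module

/-- Carter's lemma for involutions. -/
theorem reflectionLength_eq_finrank [Finite W] {v : W} (hv : v ^ 2 = 1) :
    cs.reflectionLength v = Module.finrank ℝ (cs.movedSpace v) := by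
  have hB := cs.finite_index
  refine le_antisymm ?_ (cs.finrank_movedSpace_le v)
  induction hn : Module.finrank ℝ (cs.movedSpace v) using Nat.strong_induction_on
    generalizing v with
  | _ n ih =>
    subst hn
    rcases eq_or_ne v 1 with rfl | hv1
    · rw [reflectionLength_one]; exact Nat.zero_le _
    obtain ⟨w, I, hmem, hneg⟩ := cs.exists_conj_mem_standardParabolic hv
    obtain ⟨i, hi⟩ : I.Nonempty := by
      rw [Set.nonempty_iff_ne_empty]
      rintro rfl
      rw [standardParabolic, Set.image_empty, Subgroup.closure_empty, Subgroup.mem_bot,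
        conj_eq_one_iff] at hmem
      exact hv1 hmem
    have hcomm := cs.simple_commute (hneg i hi)
    -- Richardson's result supplies a root `β` negated by `v`, whose reflection `t` commutes with
    -- `v`. So `t * v` is again an involution.
    set t := w⁻¹ * cs.simple i * w with ht
    have htr : cs.IsReflection t := ⟨w⁻¹, i, by rw [inv_inv]⟩
    have htv : t * v = v * t := by
      rw [ht]
      apply mul_left_cancel (a := w)
      apply mul_right_cancel (b := w⁻¹)
      simp only [mul_assoc, mul_inv_cancel_left, mul_inv_cancel, mul_one] at hcomm ⊢
      exact hcomm.symm
    have htv2 : (t * v) ^ 2 = 1 := by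
      rw [Commute.mul_pow htv, hv, htr.pow_two, one_mul]
    set β := cs.geomRep w⁻¹ (Finsupp.single i 1) with hβ
    have hvβ : cs.geomRep v β = -β := by
      have := congrArg (cs.geomRep w⁻¹) (hneg i hi)
      rw [← geomRep_mul, map_neg, ← mul_assoc, ← mul_assoc, inv_mul_cancel, one_mul,
        geomRep_mul] at this
      exact this
    have htβ : cs.geomRep t β = -β := by
      rw [ht, hβ, ← geomRep_mul, mul_inv_cancel_right, geomRep_mul, geomRep_simple_single, map_neg]
    have hβ0 : β ≠ 0 := by
      intro h
      have := cs.geomRep_apply_inv w (Finsupp.single i 1)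
      rw [← hβ, h, map_zero] at this
      simpa using this.symm
    have hβv : β ∈ cs.movedSpace v := (cs.mem_movedSpace_iff_of_sq_eq_one hv).2 hvβ
    -- The moved space shrinks strictly: `t * v` fixes `β`, which lies in the moved space of `v`.
    have hlt : cs.movedSpace (t * v) < cs.movedSpace v := by
      refine lt_of_le_of_ne ?_ ?_
      · have := cs.movedSpace_reflection_mul_le w⁻¹ i v
        rw [inv_inv, ← ht, ← hβ] at this
        exact this.trans (sup_le ((Submodule.span_singleton_le_iff_mem _ _).2 hβv) le_rfl)
      · intro h
        rw [← h, cs.mem_movedSpace_iff_of_sq_eq_one htv2, geomRep_mul, hvβ, map_neg, htβ,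
          neg_neg] at hβv
        exact hβ0 (self_eq_neg.1 hβv)
    have hlt' := Submodule.finrank_lt_finrank_of_lt hlt
    have h1 := ih _ hlt' htv2 rfl
    have h2 := cs.reflectionLength_mul_le htr (t * v)
    rw [← mul_assoc, htr.mul_self, one_mul] at h2
    omega

theorem finrank_eq_rank [Finite B] : Module.finrank ℝ (B →₀ ℝ) = cs.rank := by
  cases nonempty_fintype B
  rw [Module.finrank_finsupp_self, rank, Nat.card_eq_fintype_card]

/-! ### Elements acting as `-1` -/

/-- `u` acts as `-1` in the geometric representation. -/
def ActsAsNegOne (u : W) : Prop := ∀ x, cs.geomRep u x = -x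

theorem actsAsNegOne_of_single {u : W}
    (h : ∀ i, cs.geomRep u (Finsupp.single i 1) = -Finsupp.single i 1) : cs.ActsAsNegOne u := by
  intro x
  have : cs.geomRep u = -LinearMap.id := by
    refine Finsupp.lhom_ext' fun i => LinearMap.ext_ring ?_
    simpa using h i
  rw [this]; rfl

theorem actsAsNegOne_iff_reflectionLength [Finite W] {u : W} (hu : u ^ 2 = 1) :
    cs.ActsAsNegOne u ↔ cs.reflectionLength u = cs.rank := by
  have hB := cs.finite_index
  rw [cs.reflectionLength_eq_finrank hu, ← finrank_eq_rank]
  have : cs.ActsAsNegOne u ↔ cs.movedSpace u = ⊤ := by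
    rw [Submodule.eq_top_iff']
    exact forall_congr' fun x => (cs.mem_movedSpace_iff_of_sq_eq_one hu).symm
  rw [this]
  exact ⟨fun h => by rw [h, finrank_top], Submodule.eq_top_of_finrank_eq⟩

theorem actsAsNegOne_iff_parabolicClosure [Finite W] {u : W} (hu : u ^ 2 = 1) :
    cs.ActsAsNegOne u ↔ cs.parabolicClosure u = ⊤ := by
  constructor
  · intro h
    refine top_le_iff.1 (le_sInf ?_)
    rintro _ ⟨⟨I, w, rfl⟩, z, hz, hzu⟩
    have hz' : w * z * w⁻¹ = u := hzu
    -- A conjugate of `-1` is `-1` and so changes every coordinate.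
    have hI : I = Set.univ := by
      rw [Set.eq_univ_iff_forall]
      intro i
      by_contra hi
      have h1 := cs.geomRep_apply_of_mem_standardParabolic hz (Finsupp.single i 1) hi
      have h2 : z = w⁻¹ * u * w := by rw [← hz']; group
      rw [h2, geomRep_mul, geomRep_mul, h, map_neg, geomRep_inv_apply] at h1
      simp at h1
      linarith
    rw [hI, standardParabolic_univ]
    exact (Subgroup.map_top_of_surjective _ (MulAut.conj w).surjective).ge
  · intro h
    obtain ⟨w, I, hmem, hneg⟩ := cs.exists_conj_mem_standardParabolic hu
    have hle : cs.parabolicClosure u ≤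
        (cs.standardParabolic I).map (MulAut.conj w⁻¹).toMonoidHom :=
      sInf_le ⟨⟨I, w⁻¹, rfl⟩, _, hmem, by simp [mul_assoc]⟩
    rw [h, top_le_iff] at hle
    have hI : cs.standardParabolic I = ⊤ := by
      rw [Subgroup.eq_top_iff']
      intro x
      obtain ⟨y, hy, hxy⟩ := (hle ▸ Subgroup.mem_top (w⁻¹ * x * w) :
        w⁻¹ * x * w ∈ (cs.standardParabolic I).map (MulAut.conj w⁻¹).toMonoidHom)
      have : y = x := by simpa using hxy
      exact this ▸ hy
    rw [standardParabolic_eq_top_iff] at hI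
    have hn := cs.actsAsNegOne_of_single fun i => hneg i (hI ▸ Set.mem_univ i)
    intro x
    have := congrArg (cs.geomRep w⁻¹) (hn (cs.geomRep w x))
    rwa [← geomRep_mul, ← geomRep_mul, map_neg, geomRep_inv_apply,
      show w⁻¹ * (w * u * w⁻¹) * w = u by group] at this

theorem actsAsNegOne_iff_mem_center (hirr : cs.IsIrreducible) {u : W} (hu : u ^ 2 = 1)
    (hu1 : u ≠ 1) : cs.ActsAsNegOne u ↔ u ∈ Subgroup.center W := by
  constructor
  · intro h
    rw [Subgroup.mem_center_iff]
    intro g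
    apply cs.geomRep_injective
    refine LinearMap.ext fun x => ?_
    rw [geomRep_mul, geomRep_mul, h, h, map_neg]
  · intro hc
    rw [Subgroup.mem_center_iff] at hc
    have hcomm : ∀ i x, cs.geomRep u x - M.coroot i x • cs.geomRep u (Finsupp.single i 1) =
        cs.geomRep u x - M.coroot i (cs.geomRep u x) • Finsupp.single i 1 := by
      intro i x
      rw [← map_smul, ← map_sub, ← cs.geomRep_simple, ← cs.geomRep_simple, ← geomRep_mul,
        ← geomRep_mul, hc]
    have hcomm' : ∀ i x, M.coroot i x • cs.geomRep u (Finsupp.single i 1) =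
        M.coroot i (cs.geomRep u x) • Finsupp.single i 1 := fun i x =>
      sub_right_injective (hcomm i x)
    have hex : ∀ i, ∃ c : ℝ, cs.geomRep u (Finsupp.single i 1) = c • Finsupp.single i 1 := by
      intro i
      have := hcomm' i (Finsupp.single i 1)
      rw [M.coroot_self] at this
      refine ⟨(1 / 2) * M.coroot i (cs.geomRep u (Finsupp.single i 1)), ?_⟩
      rw [mul_smul, ← this, smul_smul]; norm_num
    choose c hcu using hex
    have hsq : ∀ i, c i * c i = 1 := by
      intro i
      have h1 : cs.geomRep u (cs.geomRep u (Finsupp.single i 1)) = Finsupp.single i 1 := by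
        rw [← geomRep_mul, ← pow_two, hu, geomRep_one]
      rw [hcu, map_smul, hcu, smul_smul] at h1
      simpa using DFunLike.congr_fun h1 i
    -- Evaluating the commutation with the `i`-th reflection at the `j`-th root compares the two
    -- scalars, up to a coroot value that is nonzero on edges.
    have hadj : ∀ i j, M.coxeterGraph.Adj i j → c i = c j := by
      rintro i j ⟨-, hij⟩
      have h1 := hcomm' i (Finsupp.single j 1)
      rw [hcu, hcu, map_smul, smul_smul] at h1
      have h2 := DFunLike.congr_fun h1 i
      simp only [Finsupp.smul_apply, Finsupp.single_eq_same, smul_eq_mul, mul_one] at h2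
      apply mul_left_cancel₀ (M.coroot_ne_zero hij)
      rw [h2, mul_comm]
    have hconst : ∀ i j, c i = c j := by
      intro i j
      obtain ⟨p⟩ := hirr.preconnected i j
      induction p with
      | nil => rfl
      | cons h _ ih => exact (hadj _ _ h).trans ih
    obtain ⟨i₀⟩ := hirr.nonempty
    rcases mul_self_eq_one_iff.1 (hsq i₀) with h1 | h1
    · refine absurd (cs.geomRep_injective (Finsupp.lhom_ext' fun i => LinearMap.ext_ring ?_)) hu1
      simpa [geomRep_one, hconst i i₀, h1] using hcu i
    · exact cs.actsAsNegOne_of_single fun i => by rw [hcu, hconst i i₀, h1, neg_one_smul]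

theorem ActsAsNegOne.isLongestElement [Finite W] {cs : CoxeterSystem M W} {u : W}
    (h : cs.ActsAsNegOne u) : cs.IsLongestElement u := by
  obtain ⟨v, hv⟩ := Finite.exists_max cs.length
  -- If `z` has maximal length, every `i` is a right descent, so `z` makes all simple roots
  -- nonpositive. A right descent `i` of `u * z` would make `z` send the `i`-th root to a
  -- nonnegative vector too, hence to zero. Thus `u * z = 1`, which also gives uniqueness.
  have key : ∀ z, (∀ x, cs.length x ≤ cs.length z) → z = u⁻¹ := by
    intro z hz
    rw [← mul_eq_one_iff_eq_inv]
    by_contra hne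
    obtain ⟨i, hi⟩ := cs.exists_rightDescent_of_ne_one hne
    have hzi : cs.IsRightDescent z i := by
      by_contra hcon
      rw [cs.not_isRightDescent_iff] at hcon
      have := hz (z * cs.simple i)
      omega
    have h0 : cs.geomRep z (Finsupp.single i 1) = 0 := by
      ext b
      have h1 := cs.geomRep_single_nonpos hi b
      rw [geomRep_mul, h, map_neg, Finsupp.neg_apply] at h1
      have h2 := cs.geomRep_single_nonpos hzi b
      rw [Finsupp.zero_apply]
      linarith
    have := cs.geomRep_inv_apply z (Finsupp.single i 1)
    rw [h0, map_zero] at this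
    simpa using this.symm
  have hinv : u⁻¹ = u := by
    rw [inv_eq_iff_mul_eq_one]
    apply cs.geomRep_injective
    refine LinearMap.ext fun x => ?_
    rw [geomRep_mul, h, h, neg_neg, geomRep_one]
  rw [hinv] at key
  obtain rfl := key v hv
  intro w hw
  refine lt_of_le_of_ne (hv w) fun heq => hw (key w fun x => heq ▸ hv x)

theorem ActsAsNegOne.absLE_iff [Finite W] {cs : CoxeterSystem M W} {u : W} (hu : u ^ 2 = 1)
    (h : cs.ActsAsNegOne u) {v : W} : cs.AbsLE v u ↔ v ^ 2 = 1 := by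
  have hB := cs.finite_index
  have hneg : ∀ x, cs.geomRep (v⁻¹ * u) x = -cs.geomRep v⁻¹ x := fun x => by
    rw [geomRep_mul, h, map_neg]
  have hsup : cs.movedSpace v ⊔ cs.movedSpace (v⁻¹ * u) = ⊤ := by
    rw [Submodule.eq_top_iff']
    intro x
    refine Submodule.mem_sup.2 ⟨(1 / 2 : ℝ) • (cs.geomRep v (cs.geomRep v⁻¹ x) - cs.geomRep v⁻¹ x),
      Submodule.smul_mem _ _ ⟨_, rfl⟩, (-1 / 2 : ℝ) • (cs.geomRep (v⁻¹ * u) x - x),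
      Submodule.smul_mem _ _ ⟨_, rfl⟩, ?_⟩
    rw [geomRep_apply_inv, hneg]
    module
  have hdim := Submodule.finrank_sup_add_finrank_inf_eq (cs.movedSpace v) (cs.movedSpace (v⁻¹ * u))
  rw [hsup, finrank_top, finrank_eq_rank cs] at hdim
  rw [AbsLE, (cs.actsAsNegOne_iff_reflectionLength hu).1 h]
  constructor
  · intro heq
    have h1 := cs.finrank_movedSpace_le v
    have h2 := cs.finrank_movedSpace_le (v⁻¹ * u)
    -- The dimensions are bounded by reflection lengths adding up to the rank, and the two spaces
    -- span, so there is no room for an intersection.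
    have h3 : cs.movedSpace v ⊓ cs.movedSpace (v⁻¹ * u) = ⊥ :=
      Submodule.finrank_eq_zero.1 (by omega)
    rw [pow_two, mul_eq_one_iff_eq_inv]
    apply cs.geomRep_injective
    refine LinearMap.ext fun x => sub_eq_zero.1 ?_
    rw [← Submodule.mem_bot ℝ, ← h3]
    refine ⟨⟨x + cs.geomRep v⁻¹ x, ?_⟩, ⟨x - cs.geomRep v x, ?_⟩⟩
    · rw [LinearMap.sub_apply, Module.End.one_apply, map_add, geomRep_apply_inv]
      abel
    · rw [LinearMap.sub_apply, Module.End.one_apply, hneg, map_sub, geomRep_inv_apply]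
      abel
  · intro hv
    have hinv : v⁻¹ = v := by rw [inv_eq_iff_mul_eq_one, ← pow_two, hv]
    have hvu : (v⁻¹ * u) ^ 2 = 1 := by
      apply cs.geomRep_injective
      refine LinearMap.ext fun x => ?_
      rw [pow_two, geomRep_mul, hneg, hneg, map_neg, neg_neg, ← geomRep_mul, hinv, ← pow_two, hv]
    rw [cs.reflectionLength_eq_finrank hv, cs.reflectionLength_eq_finrank hvu]
    have h3 : cs.movedSpace v ⊓ cs.movedSpace (v⁻¹ * u) = ⊥ := by
      rw [Submodule.eq_bot_iff]
      rintro x ⟨hx1, hx2⟩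
      have h1 := (cs.mem_movedSpace_iff_of_sq_eq_one hv).1 hx1
      have h2 := (cs.mem_movedSpace_iff_of_sq_eq_one hvu).1 hx2
      rw [hneg, hinv, h1, neg_neg] at h2
      exact self_eq_neg.1 h2
    rw [h3, finrank_bot] at hdim
    omega

/-- For a simple reflection `s ≤_T u`, the space spanned by its root and the moved space of `s * u`
contains that of `u` and has dimension at most `1 + ℓ_T(s u) ≤ ℓ_T(u)`, the dimension of the moved
space of `u`. So the two are equal, and `u` negates the root. -/
theorem actsAsNegOne_of_forall_absLE [Finite W] {u : W} (hu : u ^ 2 = 1)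
    (h : ∀ t, cs.IsReflection t → cs.AbsLE t u) : cs.ActsAsNegOne u := by
  have hB := cs.finite_index
  refine cs.actsAsNegOne_of_single fun i => ?_
  rw [← cs.mem_movedSpace_iff_of_sq_eq_one hu]
  have h1 := h _ (cs.isReflection_simple i)
  rw [AbsLE, inv_simple] at h1
  have hs : 1 ≤ cs.reflectionLength (cs.simple i) := by
    refine le_trans ?_ (cs.finrank_movedSpace_le _)
    rw [Nat.one_le_iff_ne_zero, Ne, Submodule.finrank_eq_zero, ← Ne, Submodule.ne_bot_iff]
    exact ⟨Finsupp.single i 1, (cs.mem_movedSpace_iff_of_sq_eq_one (cs.simple_sq i)).2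
      (cs.geomRep_simple_single i), by simp⟩
  have h2 := cs.finrank_movedSpace_le (cs.simple i * u)
  have hle := cs.movedSpace_reflection_mul_le 1 i (cs.simple i * u)
  rw [one_mul, inv_one, mul_one, simple_mul_simple_cancel_left, geomRep_one] at hle
  have h3 := Submodule.finrank_add_le_finrank_add_finrank
    (Submodule.span ℝ {Finsupp.single i 1}) (cs.movedSpace (cs.simple i * u))
  have h4 := finrank_span_le_card (R := ℝ) ({Finsupp.single i 1} : Set (B →₀ ℝ))
  simp only [Set.toFinset_singleton, Finset.card_singleton] at h4
  rw [cs.reflectionLength_eq_finrank hu] at h1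
  rw [Submodule.eq_of_le_of_finrank_le hle (by omega)]
  exact Submodule.mem_sup_left (Submodule.mem_span_singleton_self _)

end CoxeterSystem

/-! ### The main theorem -/

theorem mainTheorem6 {B W : Type*} [Group W] [Finite W] {M : CoxeterMatrix B}
    (cs : CoxeterSystem M W) (hirr : cs.IsIrreducible)
    (u : W) (hu : u ^ 2 = 1) (hu1 : u ≠ 1) :
    [cs.parabolicClosure u = ⊤,
      ∀ t : W, cs.IsReflection t → cs.AbsLE t u,
      u ∈ Subgroup.center W,
      cs.reflectionLength u = cs.rank].TFAE ∧
    (cs.parabolicClosure u = ⊤ →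
      cs.IsLongestElement u ∧ cs.absInterval 1 u = {v : W | v ^ 2 = 1}) := by
  -- Conditions 1, 3 and 4 all become `cs.ActsAsNegOne u`; only the absolute order remains to be
  -- compared with it.
  rw [← cs.actsAsNegOne_iff_parabolicClosure hu, ← cs.actsAsNegOne_iff_mem_center hirr hu hu1,
    ← cs.actsAsNegOne_iff_reflectionLength hu]
  refine ⟨?_, fun h => ⟨h.isLongestElement, ?_⟩⟩
  · tfae_have 1 → 2 := fun h t ht => (h.absLE_iff hu).2 ht.pow_two
    tfae_have 2 → 1 := cs.actsAsNegOne_of_forall_absLE hu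
    tfae_have 1 ↔ 3 := Iff.rfl
    tfae_have 1 ↔ 4 := Iff.rfl
    tfae_finish
  · ext v
    have h1 : cs.AbsLE 1 v := by
      rw [CoxeterSystem.AbsLE, cs.reflectionLength_one, inv_one, one_mul, zero_add]
    exact ⟨fun hv => (h.absLE_iff hu).1 hv.2, fun hv => ⟨h1, (h.absLE_iff hu).2 hv⟩⟩
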